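/- Let $b\in\mathbb R\setminus\{0\}$, $p\in(1,2]$, $1/p+1/p'=1$, $h\ge 0$ and $d\in\mathbb N$. A sequence $\{\mu_n\}_{n\in\mathbb Z}$ of complex numbers is called incompressible of density $d$ if $$\operatorname{card}\{n\in\mathbb Z:\ |\operatorname{Re}\mu_n-t|\le 1\}\le d\qquad\text{for every } t\in\mathbb R .$$ Let $\Pi_h:=\{z\in\mathbb C:\ |\operatorname{Im}z|\le h\}$, and for $g\in L^p[0,1]$ (complex-valued) put $G_g(\lambda):=\int_0^1 g(t)e^{ib\lambda t}\,dt$, $\lambda\in\mathbb C$. Then there exists a constant $C=C(b,p,h,d)>0$ such that for every incompressible sequence $\{\mu_n\}_{n\in\mathbb Z}$ of density $d$ lying in $\Pi_h$ and every $g\in L^p[0,1]$, $$\sum_{n\in\mathbb Z}|G_g(\mu_n)|^{p'}\le C\,\|g\|_p^{p'}\qquad\text{and}\qquad \sum_{n\in\mathbb Z}(1+|n|)^{p-2}|G_g(\mu_n)|^{p}\le C\,\|g\|_p^{p},$$ where $\|g\|_p$ is the norm of $L^p[0,1]$; in particular both series converge. -/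

import Mathlib

open MeasureTheory

noncomputable section

/-- The closed horizontal strip `{z : |Im z| ≤ h}` of semi-width `h`. -/
def horizontalStrip (h : ℝ) : Set ℂ := {z | |z.im| ≤ h}

/-- The sequence `μ` is incompressible of density `d`: every vertical strip
`[t - 1, t + 1] × ℝ` contains at most `d` entries of the sequence, counted with repetition
(that is, indices are counted). -/
def IsIncompressible (d : ℕ) (μ : ℤ → ℂ) : Prop :=
  ∀ t : ℝ, {n : ℤ | |(μ n).re - t| ≤ 1}.encard ≤ (d : ℕ∞)

/-- The finite Fourier transform `G_g(z) = ∫₀¹ g(t) exp(i b z t) dt` with frequency factor `b`. -/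
def finiteFourier (b : ℝ) (g : ℝ → ℂ) (z : ℂ) : ℂ :=
  ∫ t in (0 : ℝ)..1, g t * Complex.exp (Complex.I * (b : ℂ) * z * (t : ℂ))

/-- Lebesgue measure on the unit interval `[0, 1]`. -/
def unitIntervalMeasure : Measure ℝ := volume.restrict (Set.Icc (0 : ℝ) 1)

/-- The `L^p[0,1]` norm, as a real number (meaningful for `g` in `L^p[0,1]`). -/
def unitIntervalLpNorm (p : ℝ) (g : ℝ → ℂ) : ℝ :=
  (eLpNorm g (ENNReal.ofReal p) unitIntervalMeasure).toReal

end

/-! Two endpoint bounds are interpolated. At `p = 1` the strip condition gives `|G_g(μ_n)| ≤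
exp(|b|h) ‖g‖₁`. At `p = 2`, `exp(ibzt)` is expanded in a Taylor series about the lattice point
`2πm/b` nearest to `Re z`. The coefficients are Fourier coefficients of `t^k g(t)`, controlled by
Parseval uniformly in `k`, and incompressibility bounds how many indices share one lattice point
(`exists_sum_sq_finiteFourier_le`).

For weights `w` with at most `A y` of them below each `y`, give the index `n` mass `w_n⁻²` and
consider the map `g ↦ (w_n G_g(μ_n))`. It is of weak type (1,1) and strong type (2,2), so a
Marcinkiewicz argument (`sum_weighted_rpow_le`) bounds `∑ w_n^(p-2) |G_g(μ_n)|^p` by `‖g‖_p^p`, with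
a constant depending on `w` only through `A`.

The weights may therefore depend on `g`. Taking `w_n = 1 + |n|` gives the second inequality. Taking
`w_n` to be the rank of `|G_g(μ_n)|` in decreasing order gives a Paley inequality for the
rearrangement, which implies the Hausdorff-Young bound (`sum_rpow_conjugate_le_of_rank`). All
estimates are for finite index sets with uniform constants, so convergence follows. -/

/-! ### Counting and the `L²` endpoint -/

/-- A window of half-width `L` contains boundedly many terms of an incompressible sequence. -/
theorem IsIncompressible.card_filter_le {d : ℕ} {μ : ℤ → ℂ} (hμ : IsIncompressible d μ)
    (S : Finset ℤ) (t L : ℝ) :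
    (S.filter fun n => |(μ n).re - t| ≤ L).card ≤ d * (2 * ⌈L⌉₊ + 1) := by
  classical
  set T := S.filter fun n => |(μ n).re - t| ≤ L
  -- The windows of half-width 1 centred at `t + 2j` cover the line; `q n` picks one that contains
  -- `Re μ_n`. Only `|j| ≤ ⌈L⌉₊` can occur.
  let q : ℤ → ℤ := fun n => round (((μ n).re - t) / 2)
  have hmaps : ∀ n ∈ T, q n ∈ Finset.Icc (-(⌈L⌉₊ : ℤ)) ⌈L⌉₊ := by
    intro n hn
    have h1 : |(μ n).re - t| ≤ L := (Finset.mem_filter.1 hn).2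
    have h2 := abs_le.1 h1
    have h3 := abs_le.1 (abs_sub_round (((μ n).re - t) / 2))
    have h4 := Nat.le_ceil L
    have hq : |((q n : ℤ) : ℝ)| < (⌈L⌉₊ : ℝ) + 1 := by
      rw [abs_lt]
      constructor <;> (simp only [q]; linarith [abs_nonneg ((μ n).re - t)])
    rw [abs_lt] at hq
    have h5 : -((⌈L⌉₊ : ℤ) + 1) < q n := by exact_mod_cast hq.1
    have h6 : q n < (⌈L⌉₊ : ℤ) + 1 := by exact_mod_cast hq.2
    rw [Finset.mem_Icc]
    omega
  have hfib : ∀ j ∈ Finset.Icc (-(⌈L⌉₊ : ℤ)) ⌈L⌉₊, (T.filter fun n => q n = j).card ≤ d := by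
    intro j _
    have h1 := hμ (t + 2 * j)
    have h2 : ((T.filter fun n => q n = j : Finset ℤ) : Set ℤ) ⊆
        {n : ℤ | |(μ n).re - (t + 2 * j)| ≤ 1} := by
      intro n hn
      have hj : q n = j := (Finset.mem_filter.1 (Finset.mem_coe.1 hn)).2
      have h3 := abs_le.1 (abs_sub_round (((μ n).re - t) / 2))
      change _ ≤ _ - ((q n : ℤ) : ℝ) ∧ _ - ((q n : ℤ) : ℝ) ≤ _ at h3
      rw [hj] at h3
      rw [Set.mem_ofPred_eq, abs_le]
      constructor <;> linarith
    have h3 := (Set.encard_le_encard h2).trans h1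
    rw [Set.encard_coe_eq_coe_finsetCard] at h3
    exact_mod_cast h3
  have := Finset.card_le_mul_card_image_of_maps_to hmaps d hfib
  rw [Int.card_Icc] at this
  convert this using 2
  omega

/-- Parseval, with `|t^k| ≤ 1` on `(0, 1]`. Uniformity in `k` is what allows the Taylor series to be
summed afterwards. -/
theorem sum_sq_fourierCoeffOn_le {g : ℝ → ℂ}
    (hg : MemLp g 2 (volume.restrict (Set.Ioc (0 : ℝ) 1))) (k : ℕ) (S : Finset ℤ) :
    ∑ m ∈ S, ‖fourierCoeffOn zero_lt_one (fun t : ℝ => (t : ℂ) ^ k * g t) m‖ ^ 2 ≤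
      ∫ t in (0 : ℝ)..1, ‖g t‖ ^ 2 := by
  have hle : ∀ᵐ t : ℝ ∂(volume.restrict (Set.Ioc (0 : ℝ) 1)), ‖(t : ℂ) ^ k * g t‖ ≤ ‖g t‖ := by
    filter_upwards [ae_restrict_mem measurableSet_Ioc] with t ht
    rw [norm_mul, norm_pow, Complex.norm_real, Real.norm_eq_abs, abs_of_pos ht.1]
    exact mul_le_of_le_one_left (norm_nonneg _) (pow_le_one₀ ht.1.le ht.2)
  have hk : MemLp (fun t : ℝ => (t : ℂ) ^ k * g t) 2 (volume.restrict (Set.Ioc (0 : ℝ) 1)) :=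
    hg.mono (((by fun_prop : Continuous fun t : ℝ => (t : ℂ) ^ k).aestronglyMeasurable).mul hg.1) hle
  have hs := hasSum_sq_fourierCoeffOn zero_lt_one hk
  refine (sum_le_hasSum S (fun _ _ => by positivity) hs).trans ?_
  rw [sub_zero, inv_one, one_smul, intervalIntegral.integral_of_le zero_le_one,
    intervalIntegral.integral_of_le zero_le_one]
  refine integral_mono_ae ?_ ?_ ?_
  · exact hk.norm.integrable_sq
  · exact hg.norm.integrable_sq
  · filter_upwards [hle] with t ht
    exact pow_le_pow_left₀ (norm_nonneg _) ht 2

/-- Taylor expansion of the finite Fourier transform around a lattice point. -/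
theorem hasSum_finiteFourier {g : ℝ → ℂ} (hg : IntervalIntegrable g volume 0 1)
    (b : ℝ) (z : ℂ) (m : ℤ) :
    HasSum (fun k : ℕ => (Complex.I * (b * z - 2 * Real.pi * m)) ^ k / (k.factorial : ℂ) *
      fourierCoeffOn zero_lt_one (fun t : ℝ => (t : ℂ) ^ k * g t) (-m)) (finiteFourier b g z) := by
  -- Here `exp(ibzt) = exp(2πimt) exp(δt)`, and the second factor is expanded. The index is `-m`
  -- because Fourier coefficients integrate against the conjugate character.
  set δ : ℂ := Complex.I * (b * z - 2 * Real.pi * m) with hδ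
  have key : HasSum (fun k : ℕ => ∫ t in (0 : ℝ)..1,
      δ ^ k / (k.factorial : ℂ) * (fourier m (t : AddCircle (1 - 0 : ℝ)) * ((t : ℂ) ^ k * g t)))
      (∫ t in (0 : ℝ)..1, g t * Complex.exp (Complex.I * (b : ℂ) * z * (t : ℂ))) := by
    refine intervalIntegral.hasSum_integral_of_dominated_convergence
      (fun k t => ‖δ‖ ^ k / (k.factorial : ℝ) * ‖g t‖) ?_ ?_ ?_ ?_ ?_
    · intro k
      have hg1 : AEStronglyMeasurable g (volume.restrict (Set.uIoc 0 1)) := by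
        rw [Set.uIoc_of_le zero_le_one]; exact hg.1.1
      refine AEStronglyMeasurable.mul (by fun_prop) (AEStronglyMeasurable.mul ?_
        (AEStronglyMeasurable.mul (by fun_prop) hg1))
      exact ((map_continuous (fourier m)).comp (AddCircle.continuous_mk' _)).aestronglyMeasurable
    · intro k
      refine Filter.Eventually.of_forall fun t ht => ?_
      rw [Set.uIoc_of_le zero_le_one] at ht
      rw [norm_mul, norm_mul, norm_mul, norm_div, norm_pow, norm_pow, Complex.norm_natCast,
        Complex.norm_real, Real.norm_eq_abs, abs_of_pos ht.1, fourier_apply, Circle.norm_coe,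
        one_mul]
      gcongr
      exact mul_le_of_le_one_left (norm_nonneg _) (pow_le_one₀ ht.1.le ht.2)
    · exact Filter.Eventually.of_forall fun t _ => (Real.summable_pow_div_factorial _).mul_right _
    · simp_rw [tsum_mul_right]
      exact hg.norm.const_mul _
    · refine Filter.Eventually.of_forall fun t _ => ?_
      have h1 := NormedSpace.expSeries_div_hasSum_exp (δ * (t : ℂ))
      have h2 := h1.mul_right (fourier m (t : AddCircle (1 - 0 : ℝ)) * g t)
      rw [← Complex.exp_eq_exp_ℂ, fourier_coe_apply, ← mul_assoc, ← Complex.exp_add] at h2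
      have h3 : g t * Complex.exp (Complex.I * (b : ℂ) * z * (t : ℂ)) =
          Complex.exp (δ * t + 2 * Real.pi * Complex.I * m * t / ((1 - 0 : ℝ) : ℂ)) * g t := by
        rw [mul_comm, hδ]
        congr 2
        push_cast
        ring
      rw [h3]
      clear_value δ
      refine h2.congr_fun fun k => ?_
      rw [fourier_coe_apply, mul_pow]
      ring
  unfold finiteFourier
  convert key using 2 with k
  rw [intervalIntegral.integral_const_mul, fourierCoeffOn_eq_integral]
  simp

/-- Cauchy-Schwarz for weights of total mass `E`, obtained by expanding `∑ r_k (c_k - s/E)² ≥ 0`. It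
leaves squares of coefficients, to which Parseval applies for each `k`. -/
theorem sq_tsum_mul_le {r c : ℕ → ℝ} {E s q : ℝ} (hr : ∀ k, 0 ≤ r k) (hE : HasSum r E)
    (hs : HasSum (fun k => r k * c k) s) (hq : HasSum (fun k => r k * c k ^ 2) q) (hE0 : 0 < E) :
    s ^ 2 ≤ E * q := by
  have h := (hq.sub (hs.mul_left (2 * (s / E)))).add (hE.mul_left ((s / E) ^ 2))
  have h0 := h.nonneg fun k => by
    have : r k * c k ^ 2 - 2 * (s / E) * (r k * c k) + (s / E) ^ 2 * r k =
      r k * (c k - s / E) ^ 2 := by ring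
    rw [this]
    exact mul_nonneg (hr k) (sq_nonneg _)
  have h1 : E * (q - 2 * (s / E) * s + (s / E) ^ 2 * E) = E * q - s ^ 2 := by
    field_simp
    ring
  nlinarith [mul_nonneg hE0.le h0]

/-- A Plancherel-Polya type bound in `L²`. -/
theorem exists_sum_sq_finiteFourier_le {b : ℝ} (hb : b ≠ 0) (h : ℝ) (d : ℕ) :
    ∃ C : ℝ, 0 ≤ C ∧ ∀ μ : ℤ → ℂ, IsIncompressible d μ → (∀ n : ℤ, μ n ∈ horizontalStrip h) →
      ∀ g : ℝ → ℂ, MemLp g 2 (volume.restrict (Set.Ioc (0 : ℝ) 1)) → ∀ S : Finset ℤ,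
        ∑ n ∈ S, ‖finiteFourier b g (μ n)‖ ^ 2 ≤ C * ∫ t in (0 : ℝ)..1, ‖g t‖ ^ 2 := by
  classical
  -- `D` bounds the number of indices rounded to one lattice point; `R` bounds the distance `|bz -
  -- 2πm|`, with `π` from rounding the real part and `|b||h|` from the strip.
  set D : ℕ := d * (2 * ⌈Real.pi / |b|⌉₊ + 1) with hD
  set R : ℝ := Real.pi + |b| * |h| with hR
  have hR0 : 0 ≤ R := by positivity
  refine ⟨Real.exp R * (Real.exp R * D), by positivity, ?_⟩
  intro μ hμ hstrip g hg S
  have hgi : IntervalIntegrable g volume 0 1 := by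
    rw [intervalIntegrable_iff_integrableOn_Ioc_of_le zero_le_one]
    exact hg.integrable one_le_two
  set Q : ℝ := ∫ t in (0 : ℝ)..1, ‖g t‖ ^ 2 with hQ
  set c : ℤ → ℕ → ℝ := fun m k =>
    ‖fourierCoeffOn zero_lt_one (fun t : ℝ => (t : ℂ) ^ k * g t) (-m)‖ with hc
  have hcsum : ∀ k (T : Finset ℤ), ∑ m ∈ T, c m k ^ 2 ≤ Q := by
    intro k T
    have := sum_sq_fourierCoeffOn_le hg k (T.image fun m => -m)
    rwa [Finset.sum_image (fun x _ y _ hxy => neg_injective hxy)] at this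
  have hQ0 : 0 ≤ Q := by simpa using hcsum 0 ∅
  have hc0 : ∀ m k, 0 ≤ c m k := fun m k => norm_nonneg _
  have hcQ : ∀ m k, c m k ^ 2 ≤ Q := fun m k => by simpa using hcsum k {m}
  -- A crude bound, used only for summability in `k`.
  have hcQ' : ∀ m k, c m k ≤ 1 + Q := fun m k => by nlinarith [hcQ m k, sq_nonneg (c m k - 1)]
  set r : ℕ → ℝ := fun k => R ^ k / (k.factorial : ℝ) with hr
  have hr0 : ∀ k, 0 ≤ r k := fun k => by positivity
  have hrE : HasSum r (Real.exp R) := by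
    rw [Real.exp_eq_exp_ℝ]
    exact NormedSpace.expSeries_div_hasSum_exp R
  have hs1 : ∀ m, Summable fun k => r k * c m k := fun m =>
    Summable.of_nonneg_of_le (fun k => mul_nonneg (hr0 k) (hc0 m k))
      (fun k => mul_le_mul_of_nonneg_left (hcQ' m k) (hr0 k)) (hrE.summable.mul_right _)
  have hs2 : ∀ m, Summable fun k => r k * c m k ^ 2 := fun m =>
    Summable.of_nonneg_of_le (fun k => mul_nonneg (hr0 k) (sq_nonneg _))
      (fun k => mul_le_mul_of_nonneg_left (hcQ m k) (hr0 k)) (hrE.summable.mul_right _)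
  set m : ℤ → ℤ := fun n => round (b * (μ n).re / (2 * Real.pi)) with hm
  have hround : ∀ n, |b * (μ n).re - 2 * Real.pi * m n| ≤ Real.pi := by
    intro n
    have h1 := abs_sub_round (b * (μ n).re / (2 * Real.pi))
    have h2 : b * (μ n).re - 2 * Real.pi * m n =
        (2 * Real.pi) * (b * (μ n).re / (2 * Real.pi) - m n) := by
      field_simp
    rw [h2, abs_mul, abs_of_pos Real.two_pi_pos]
    have := mul_le_mul_of_nonneg_left h1 Real.two_pi_pos.le
    linarith
  have hpt : ∀ n, ‖finiteFourier b g (μ n)‖ ^ 2 ≤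
      Real.exp R * ∑' k, r k * c (m n) k ^ 2 := by
    intro n
    have hδ : ‖Complex.I * (b * μ n - 2 * Real.pi * m n)‖ ≤ R := by
      rw [norm_mul, Complex.norm_I, one_mul]
      refine (Complex.norm_le_abs_re_add_abs_im _).trans ?_
      have h1 : ((b : ℂ) * μ n - 2 * Real.pi * m n).re = b * (μ n).re - 2 * Real.pi * m n := by
        simp
      have h2 : ((b : ℂ) * μ n - 2 * Real.pi * m n).im = b * (μ n).im := by
        simp
      rw [h1, h2, abs_mul]
      have h3 : |(μ n).im| ≤ |h| := (show |(μ n).im| ≤ h from hstrip n).trans (le_abs_self h)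
      have h4 := mul_le_mul_of_nonneg_left h3 (abs_nonneg b)
      linarith [hround n]
    have h1 : ‖finiteFourier b g (μ n)‖ ≤ ∑' k, r k * c (m n) k := by
      refine (hasSum_finiteFourier hgi b (μ n) (m n)).norm_le_of_bounded (hs1 (m n)).hasSum ?_
      intro k
      rw [norm_mul, norm_div, norm_pow, Complex.norm_natCast]
      exact mul_le_mul_of_nonneg_right (by simp only [hr]; gcongr) (norm_nonneg _)
    exact (pow_le_pow_left₀ (norm_nonneg _) h1 2).trans
      (sq_tsum_mul_le hr0 hrE (hs1 _).hasSum (hs2 _).hasSum (Real.exp_pos R))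
  have hfib : ∀ j, (S.filter fun n => m n = j).card ≤ D := by
    intro j
    refine (Finset.card_le_card ?_).trans (hμ.card_filter_le S (2 * Real.pi * j / b) (Real.pi / |b|))
    intro n hn
    obtain ⟨hnS, hj⟩ := Finset.mem_filter.1 hn
    refine Finset.mem_filter.2 ⟨hnS, ?_⟩
    have h1 := hround n
    rw [hj] at h1
    have h2 : (μ n).re - 2 * Real.pi * j / b = (b * (μ n).re - 2 * Real.pi * j) / b := by
      field_simp
    rw [h2, abs_div]
    gcongr
  have hk : ∀ k, ∑ n ∈ S, r k * c (m n) k ^ 2 ≤ r k * (D * Q) := by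
    intro k
    rw [← Finset.mul_sum]
    refine mul_le_mul_of_nonneg_left ?_ (hr0 k)
    -- The sum is grouped by lattice point: each contributes at most `D` equal terms, and Parseval
    -- sums over distinct points.
    rw [Finset.sum_comp (fun j => c j k ^ 2) m]
    calc ∑ j ∈ S.image m, (S.filter fun n => m n = j).card • c j k ^ 2
        ≤ ∑ j ∈ S.image m, (D : ℝ) * c j k ^ 2 := by
          refine Finset.sum_le_sum fun j _ => ?_
          rw [nsmul_eq_mul]
          have := hfib j
          gcongr
      _ ≤ D * Q := by
          rw [← Finset.mul_sum]
          exact mul_le_mul_of_nonneg_left (hcsum k _) (Nat.cast_nonneg _)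
  calc ∑ n ∈ S, ‖finiteFourier b g (μ n)‖ ^ 2
      ≤ ∑ n ∈ S, Real.exp R * ∑' k, r k * c (m n) k ^ 2 := Finset.sum_le_sum fun n _ => hpt n
    _ = Real.exp R * ∑' k, ∑ n ∈ S, r k * c (m n) k ^ 2 := by
        rw [← Finset.mul_sum, Summable.tsum_finsetSum fun n _ => hs2 (m n)]
    _ ≤ Real.exp R * (Real.exp R * (D * Q)) := by
        refine mul_le_mul_of_nonneg_left ?_ (Real.exp_pos R).le
        exact hasSum_le hk (summable_sum fun n _ => hs2 (m n)).hasSum (hrE.mul_right (D * Q))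
    _ = Real.exp R * (Real.exp R * D) * Q := by ring

/-! ### Layer-cake formulas and weak-type interpolation -/

/-- The layer-cake formula for a Dirac mass. -/
theorem ofReal_rpow_eq_lintegral_ite {c q : ℝ} (hc : 0 ≤ c) (hq : 0 < q) :
    ENNReal.ofReal (c ^ q) = ENNReal.ofReal q *
      ∫⁻ s in Set.Ioi (0 : ℝ), if s < c then ENNReal.ofReal (s ^ (q - 1)) else 0 := by
  have h := lintegral_rpow_eq_lintegral_meas_lt_mul (Measure.dirac ()) (f := fun _ => c)
    (Filter.Eventually.of_forall fun _ => hc) aemeasurable_const hq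
  rw [lintegral_dirac] at h
  rw [h]
  congr 2
  funext s
  by_cases hs : s < c <;> simp [hs]

theorem lintegral_ite_rpow_of_lt {c r : ℝ} (hc : 0 < c) (hr : r < -1) :
    ∫⁻ s in Set.Ioi (0 : ℝ), (if c ≤ s then ENNReal.ofReal (s ^ r) else 0) =
      ENNReal.ofReal (c ^ (r + 1) / (-(r + 1))) := by
  have h1 : (fun s : ℝ => if c ≤ s then ENNReal.ofReal (s ^ r) else 0) =
      (Set.Ici c).indicator fun s => ENNReal.ofReal (s ^ r) := by
    funext s
    simp [Set.indicator_apply]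
  rw [h1, lintegral_indicator measurableSet_Ici, Measure.restrict_restrict measurableSet_Ici,
    Set.inter_eq_left.2 (Set.Ici_subset_Ioi.2 hc),
    ← restrict_Ioi_eq_restrict_Ici,
    ← ofReal_integral_eq_lintegral_ofReal (integrableOn_Ioi_rpow_of_lt hr hc),
    integral_Ioi_rpow_of_lt hr hc, neg_div, div_neg]
  filter_upwards [ae_restrict_mem measurableSet_Ioi] with s hs
  exact Real.rpow_nonneg (hc.le.trans (le_of_lt hs)) _

/-- If at most `A y` of the weights are `≤ y` for every `y`, the tails of `∑ w⁻²` are `O(1/x)`. -/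
theorem sum_filter_rpow_neg_two_le {ι : Type*} {S : Finset ι} {w : ι → ℝ} {A : ℝ}
    (hw : ∀ n ∈ S, 0 < w n) (hA : ∀ y, 0 < y → ((S.filter fun n => w n ≤ y).card : ℝ) ≤ A * y)
    {x : ℝ} (hx : 0 < x) :
    ∑ n ∈ S.filter (fun n => x < w n), ENNReal.ofReal (w n ^ (-2 : ℝ)) ≤
      ENNReal.ofReal (2 * A / x) := by
  classical
  -- `w⁻² = 2 ∫_w^∞ s⁻³ ds` turns the sum into an integral of the counting function, which is at
  -- most `A s` and vanishes for `s < x`.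
  have h1 : ∀ n ∈ S.filter (fun n => x < w n), ENNReal.ofReal (w n ^ (-2 : ℝ)) =
      2 * ∫⁻ s in Set.Ioi (0 : ℝ), (if w n ≤ s then ENNReal.ofReal (s ^ (-3 : ℝ)) else 0) := by
    intro n hn
    rw [lintegral_ite_rpow_of_lt (hw n (Finset.mem_filter.1 hn).1) (by norm_num),
      ← ENNReal.ofReal_ofNat 2, ← ENNReal.ofReal_mul (by norm_num)]
    congr 1
    norm_num
    ring
  rw [Finset.sum_congr rfl h1, ← Finset.mul_sum, ← lintegral_finsetSum]
  swap
  · intro n _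
    exact Measurable.ite measurableSet_Ici (by fun_prop) measurable_const
  have h2 : ∫⁻ s in Set.Ioi (0 : ℝ), (∑ n ∈ S.filter (fun n => x < w n),
      if w n ≤ s then ENNReal.ofReal (s ^ (-3 : ℝ)) else 0) ≤
      ∫⁻ s in Set.Ioi (0 : ℝ), ENNReal.ofReal A *
        (if x ≤ s then ENNReal.ofReal (s ^ (-2 : ℝ)) else 0) := by
    refine lintegral_mono_ae ?_
    filter_upwards [ae_restrict_mem measurableSet_Ioi] with s hs
    have hs : 0 < s := hs
    by_cases hxs : x ≤ s
    · rw [if_pos hxs, ← Finset.sum_filter, Finset.sum_const, nsmul_eq_mul]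
      have h3 : ((((S.filter fun n => x < w n).filter fun n => w n ≤ s).card : ℕ) : ℝ) ≤
          A * s := by
        refine le_trans ?_ (hA s hs)
        exact_mod_cast Finset.card_le_card
          (Finset.filter_subset_filter _ (Finset.filter_subset _ _))
      have hA0 : 0 ≤ A := by
        by_contra hneg
        have := (Nat.cast_nonneg _).trans h3
        nlinarith
      rw [← ENNReal.ofReal_natCast, ← ENNReal.ofReal_mul (Nat.cast_nonneg _),
        ← ENNReal.ofReal_mul hA0]
      refine ENNReal.ofReal_le_ofReal ?_
      have h4 : s ^ (-2 : ℝ) = s * s ^ (-3 : ℝ) := by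
        rw [← Real.rpow_one_add' hs.le (by norm_num)]
        norm_num
      rw [h4, ← mul_assoc]
      exact mul_le_mul_of_nonneg_right h3 (Real.rpow_nonneg hs.le _)
    · rw [if_neg hxs, mul_zero, nonpos_iff_eq_zero]
      refine Finset.sum_eq_zero fun n hn => if_neg ?_
      have := (Finset.mem_filter.1 hn).2
      intro h
      exact hxs (this.le.trans h)
  refine (mul_le_mul_right h2 2).trans ?_
  rw [lintegral_const_mul _ (Measurable.ite measurableSet_Ici (by fun_prop) measurable_const),
    lintegral_ite_rpow_of_lt hx (by norm_num), ← ENNReal.ofReal_ofNat 2, ← mul_assoc,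
    ← ENNReal.ofReal_mul (by norm_num), ← ENNReal.ofReal_mul' (by norm_num; positivity)]
  refine le_of_eq (congrArg _ ?_)
  norm_num
  rw [Real.rpow_neg_one]
  rfl

/-- Tonelli and `∫_0^f s^(p-2) ds = f^(p-1)/(p-1)`, where `p > 1` gives convergence at 0. This
integrates the `L¹` contribution over all truncation heights. -/
theorem lintegral_rpow_mul_lintegral_ite_lt {α : Type*} [MeasurableSpace α] {m : Measure α}
    [SFinite m] {f : α → ℝ} {p : ℝ} (hp1 : 1 < p) (hf : Measurable f) (hf0 : ∀ x, 0 ≤ f x) :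
    ∫⁻ s in Set.Ioi (0 : ℝ), ENNReal.ofReal (s ^ (p - 2)) *
      ∫⁻ x, (if s < f x then ENNReal.ofReal (f x) else 0) ∂m =
    ENNReal.ofReal (1 / (p - 1)) * ∫⁻ x, ENNReal.ofReal (f x ^ p) ∂m := by
  have hp0 : 0 < p - 1 := by linarith
  have hmeas : Measurable fun q : ℝ × α => if q.1 < f q.2 then ENNReal.ofReal (f q.2) else 0 :=
    Measurable.ite (measurableSet_lt measurable_fst (hf.comp measurable_snd)) (by fun_prop)
      measurable_const
  have h1 : ∀ s : ℝ, ENNReal.ofReal (s ^ (p - 2)) *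
      ∫⁻ x, (if s < f x then ENNReal.ofReal (f x) else 0) ∂m =
      ∫⁻ x, ENNReal.ofReal (s ^ (p - 2)) * (if s < f x then ENNReal.ofReal (f x) else 0) ∂m :=
    fun s => (lintegral_const_mul _ (hmeas.comp measurable_prodMk_left)).symm
  simp_rw [h1]
  rw [lintegral_lintegral_swap, ← lintegral_const_mul _ (by fun_prop)]
  swap
  · exact (Measurable.mul (by fun_prop) hmeas).aemeasurable
  refine lintegral_congr fun x => ?_
  have h2 : ∀ s : ℝ, ENNReal.ofReal (s ^ (p - 2)) *
      (if s < f x then ENNReal.ofReal (f x) else 0) =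
      ENNReal.ofReal (f x) * (if s < f x then ENNReal.ofReal (s ^ (p - 1 - 1)) else 0) := by
    intro s
    rw [show p - 1 - 1 = p - 2 by ring]
    split_ifs <;> simp [mul_comm]
  simp_rw [h2]
  rw [lintegral_const_mul _ (Measurable.ite measurableSet_Iio (by fun_prop) measurable_const)]
  have h3 := ofReal_rpow_eq_lintegral_ite (hf0 x) hp0
  have h4 : f x ^ p = f x * f x ^ (p - 1) := by
    rw [← Real.rpow_one_add' (hf0 x) (by linarith)]
    congr 1
    ring
  rw [h4, ENNReal.ofReal_mul (hf0 x), h3, ← mul_assoc, ← mul_assoc,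
    mul_comm (ENNReal.ofReal (1 / (p - 1))), mul_assoc (ENNReal.ofReal (f x)),
    ← ENNReal.ofReal_mul (by positivity), one_div_mul_cancel hp0.ne', ENNReal.ofReal_one, mul_one]

/-- The counterpart for the `L²` contribution: `∫_f^∞ s^(p-3) ds = f^(p-2)/(2-p)` converges at
infinity because `p < 2`. -/
theorem lintegral_rpow_mul_lintegral_ite_le {α : Type*} [MeasurableSpace α] {m : Measure α}
    [SFinite m] {f : α → ℝ} {p : ℝ} (hp1 : 1 < p) (hp2 : p < 2) (hf : Measurable f)
    (hf0 : ∀ x, 0 ≤ f x) :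
    ∫⁻ s in Set.Ioi (0 : ℝ), ENNReal.ofReal (s ^ (p - 3)) *
      ∫⁻ x, (if f x ≤ s then ENNReal.ofReal (f x ^ 2) else 0) ∂m =
    ENNReal.ofReal (1 / (2 - p)) * ∫⁻ x, ENNReal.ofReal (f x ^ p) ∂m := by
  have hmeas : Measurable fun q : ℝ × α =>
      if f q.2 ≤ q.1 then ENNReal.ofReal (f q.2 ^ 2) else 0 :=
    Measurable.ite (measurableSet_le (hf.comp measurable_snd) measurable_fst) (by fun_prop)
      measurable_const
  have h1 : ∀ s : ℝ, ENNReal.ofReal (s ^ (p - 3)) *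
      ∫⁻ x, (if f x ≤ s then ENNReal.ofReal (f x ^ 2) else 0) ∂m =
      ∫⁻ x, ENNReal.ofReal (s ^ (p - 3)) * (if f x ≤ s then ENNReal.ofReal (f x ^ 2) else 0) ∂m :=
    fun s => (lintegral_const_mul _ (hmeas.comp measurable_prodMk_left)).symm
  simp_rw [h1]
  rw [lintegral_lintegral_swap, ← lintegral_const_mul _ (by fun_prop)]
  swap
  · exact (Measurable.mul (by fun_prop) hmeas).aemeasurable
  refine lintegral_congr fun x => ?_
  have h2 : ∀ s : ℝ, ENNReal.ofReal (s ^ (p - 3)) *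
      (if f x ≤ s then ENNReal.ofReal (f x ^ 2) else 0) =
      ENNReal.ofReal (f x ^ 2) * (if f x ≤ s then ENNReal.ofReal (s ^ (p - 3)) else 0) := by
    intro s
    split_ifs <;> simp [mul_comm]
  simp_rw [h2]
  rw [lintegral_const_mul _ (Measurable.ite measurableSet_Ici (by fun_prop) measurable_const)]
  rcases (hf0 x).eq_or_lt with h0 | h0
  · rw [← h0, Real.zero_rpow (by linarith)]
    simp
  · have h4 : f x ^ p = f x ^ 2 * f x ^ (p - 2) := by
      rw [← Real.rpow_natCast, ← Real.rpow_add h0]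
      congr 1
      push_cast
      ring
    rw [lintegral_ite_rpow_of_lt h0 (by linarith), ← ENNReal.ofReal_mul (sq_nonneg _),
      ← ENNReal.ofReal_mul (one_div_nonneg.2 (by linarith)), h4,
      show p - 3 + 1 = p - 2 by ring, neg_sub]
    congr 1
    ring

/-- If `s < w a`, then `w U` or `w v` exceeds `s/2`. The first case forces `w > s/(2U)`, so the tail
bound for `∑ w⁻²` applies; the second is Chebyshev's inequality, where the mass `w⁻²` cancels the
factor `w²`. -/
theorem sum_filter_lt_mul_rpow_neg_two_le {ι : Type*} {S : Finset ι} {w a v : ι → ℝ} {A U s : ℝ}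
    (hw : ∀ n ∈ S, 0 < w n) (hA : ∀ y, 0 < y → ((S.filter fun n => w n ≤ y).card : ℝ) ≤ A * y)
    (hs : 0 < s) (hU : 0 ≤ U) (hsplit : ∀ n ∈ S, a n ≤ U + v n) :
    ∑ n ∈ S.filter (fun n => s < w n * a n), ENNReal.ofReal (w n ^ (-2 : ℝ)) ≤
      ENNReal.ofReal (4 * A / s * U) +
        ENNReal.ofReal (4 / s ^ 2) * ∑ n ∈ S, ENNReal.ofReal (v n ^ 2) := by
  classical
  have hsub : S.filter (fun n => s < w n * a n) ⊆
      S.filter (fun n => s / 2 < w n * U) ∪ S.filter (fun n => s / 2 < w n * v n) := by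
    intro n hn
    obtain ⟨hnS, hn⟩ := Finset.mem_filter.1 hn
    rw [Finset.mem_union, Finset.mem_filter, Finset.mem_filter]
    by_contra! hcon
    have h1 := hcon.1 hnS
    have h2 := hcon.2 hnS
    have h3 := mul_le_mul_of_nonneg_left (hsplit n hnS) (hw n hnS).le
    linarith
  refine (Finset.sum_le_sum_of_subset hsub).trans
    ((le_self_add.trans Finset.sum_union_inter.le).trans ?_)
  refine add_le_add ?_ ?_
  · rcases hU.eq_or_lt with hU0 | hU0
    · rw [← hU0, Finset.filter_false_of_mem, Finset.sum_empty]
      · exact zero_le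
      · intro n _
        rw [mul_zero]
        linarith
    · have h1 : S.filter (fun n => s / 2 < w n * U) = S.filter (fun n => s / (2 * U) < w n) := by
        refine Finset.filter_congr fun n _ => ?_
        rw [← div_div, div_lt_iff₀ hU0]
      rw [h1]
      refine (sum_filter_rpow_neg_two_le hw hA (by positivity)).trans (le_of_eq (congrArg _ ?_))
      field_simp
      ring
  · rw [Finset.mul_sum]
    refine (Finset.sum_le_sum fun n hn => ?_).trans
      (Finset.sum_le_sum_of_subset (Finset.filter_subset _ _))
    obtain ⟨hnS, hn⟩ := Finset.mem_filter.1 hn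
    rw [← ENNReal.ofReal_mul (by positivity)]
    refine ENNReal.ofReal_le_ofReal ?_
    have hw0 := hw n hnS
    have h1 : s ^ 2 ≤ 4 * (w n * v n) ^ 2 := by nlinarith
    rw [Real.rpow_neg hw0.le, Real.rpow_ofNat, inv_le_iff_one_le_mul₀ (by positivity)]
    rw [show 4 / s ^ 2 * v n ^ 2 * w n ^ 2 = 4 * (w n * v n) ^ 2 / s ^ 2 by ring,
      one_le_div (by positivity)]
    exact h1

/-- Weighted weak-type interpolation: each `a n` is split at every height `s` into a part bounded by
the `L¹` norm of the values of `f` above `s` and a part square-summable with the `L²` norm of the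
values below `s`. -/
theorem sum_weighted_rpow_le {ι α : Type*} [MeasurableSpace α] {m : Measure α} [SFinite m]
    {S : Finset ι} {w a : ι → ℝ} {A K B p : ℝ} {f : α → ℝ} (hp1 : 1 < p) (hp2 : p < 2)
    (hw : ∀ n ∈ S, 0 < w n) (hA : ∀ y, 0 < y → ((S.filter fun n => w n ≤ y).card : ℝ) ≤ A * y)
    (hA0 : 0 ≤ A) (hK : 0 ≤ K) (hB : 0 ≤ B) (ha : ∀ n, 0 ≤ a n) (hf : Measurable f) (hf0 : ∀ x, 0 ≤ f x)
    (hsplit : ∀ s, 0 < s → ∃ (U : ℝ) (v : ι → ℝ), 0 ≤ U ∧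
      (∀ n ∈ S, a n ≤ U + v n) ∧
      ENNReal.ofReal U ≤ ENNReal.ofReal K * ∫⁻ x, (if s < f x then ENNReal.ofReal (f x) else 0) ∂m ∧
      ∑ n ∈ S, ENNReal.ofReal (v n ^ 2) ≤
        ENNReal.ofReal B * ∫⁻ x, (if f x ≤ s then ENNReal.ofReal (f x ^ 2) else 0) ∂m) :
    ∑ n ∈ S, ENNReal.ofReal (w n ^ (p - 2) * a n ^ p) ≤
      ENNReal.ofReal (p * (4 * A * K / (p - 1) + 4 * B / (2 - p))) *
        ∫⁻ x, ENNReal.ofReal (f x ^ p) ∂m := by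
  -- Since `w^(p-2) a^p = w⁻² (w a)^p`, the layer-cake formula expresses the sum through the
  -- distribution function of `w a` under the masses `w⁻²`.
  have hLHS : ∑ n ∈ S, ENNReal.ofReal (w n ^ (p - 2) * a n ^ p) =
      ENNReal.ofReal p * ∫⁻ s in Set.Ioi (0 : ℝ), ENNReal.ofReal (s ^ (p - 1)) *
        ∑ n ∈ S.filter (fun n => s < w n * a n), ENNReal.ofReal (w n ^ (-2 : ℝ)) := by
    have h1 : ∀ n ∈ S, ENNReal.ofReal (w n ^ (p - 2) * a n ^ p) =
        ENNReal.ofReal p * ∫⁻ s in Set.Ioi (0 : ℝ), ENNReal.ofReal (w n ^ (-2 : ℝ)) *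
          (if s < w n * a n then ENNReal.ofReal (s ^ (p - 1)) else 0) := by
      intro n hn
      have hw0 := hw n hn
      rw [lintegral_const_mul _ (Measurable.ite measurableSet_Iio (by fun_prop) measurable_const),
        ← mul_assoc, mul_comm (ENNReal.ofReal p), mul_assoc,
        ← ofReal_rpow_eq_lintegral_ite (mul_nonneg hw0.le (ha n)) (by linarith : 0 < p),
        ← ENNReal.ofReal_mul (Real.rpow_nonneg hw0.le _), Real.mul_rpow hw0.le (ha n),
        ← mul_assoc, ← Real.rpow_add hw0]
      congr 3
      ring
    rw [Finset.sum_congr rfl h1, ← Finset.mul_sum, ← lintegral_finsetSum]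
    · congr 1
      refine lintegral_congr fun s => ?_
      rw [Finset.mul_sum, Finset.sum_filter]
      refine Finset.sum_congr rfl fun n _ => ?_
      split_ifs
      · rw [mul_comm]
      · rw [mul_zero]
    · intro n _
      exact (Measurable.ite measurableSet_Iio (by fun_prop) measurable_const).const_mul _
  -- The function is split at the same height `s` as the level set, so the factors `1/s` and `1/s²`
  -- from the two parts turn `s^(p-1)` into `s^(p-2)` and `s^(p-3)`.
  have hpt : ∀ s : ℝ, 0 < s → ENNReal.ofReal (s ^ (p - 1)) *
      ∑ n ∈ S.filter (fun n => s < w n * a n), ENNReal.ofReal (w n ^ (-2 : ℝ)) ≤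
      ENNReal.ofReal (4 * A * K) * (ENNReal.ofReal (s ^ (p - 2)) *
        ∫⁻ x, (if s < f x then ENNReal.ofReal (f x) else 0) ∂m) +
      ENNReal.ofReal (4 * B) * (ENNReal.ofReal (s ^ (p - 3)) *
        ∫⁻ x, (if f x ≤ s then ENNReal.ofReal (f x ^ 2) else 0) ∂m) := by
    intro s hs
    obtain ⟨U, v, hU, hsp, hUle, hvle⟩ := hsplit s hs
    refine (mul_le_mul_right
      (sum_filter_lt_mul_rpow_neg_two_le hw hA hs hU hsp) _).trans ?_
    rw [mul_add]
    have hs1 : s ^ (p - 2) = s ^ (p - 1) / s := by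
      rw [← Real.rpow_sub_one hs.ne']
      congr 1
      ring
    have hs2 : s ^ (p - 3) = s ^ (p - 1) / s ^ 2 := by
      rw [← Real.rpow_sub_natCast hs.ne']
      congr 1
      push_cast
      ring
    have hs0 : 0 ≤ s ^ (p - 1) := Real.rpow_nonneg hs.le _
    refine add_le_add ?_ ?_
    · rw [ENNReal.ofReal_mul (by positivity)]
      refine (mul_le_mul_right (mul_le_mul_right hUle _) _).trans (le_of_eq ?_)
      simp only [← mul_assoc]
      rw [← ENNReal.ofReal_mul hs0, ← ENNReal.ofReal_mul (by positivity),
        ← ENNReal.ofReal_mul (by positivity), hs1]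
      congr 2
      ring
    · refine (mul_le_mul_right (mul_le_mul_right hvle _) _).trans (le_of_eq ?_)
      simp only [← mul_assoc]
      rw [← ENNReal.ofReal_mul hs0, ← ENNReal.ofReal_mul (by positivity),
        ← ENNReal.ofReal_mul (by positivity), hs2]
      congr 2
      ring
  have hm1 : Measurable fun s : ℝ => ENNReal.ofReal (s ^ (p - 2)) *
      ∫⁻ x, (if s < f x then ENNReal.ofReal (f x) else 0) ∂m := by
    refine Measurable.mul (by fun_prop) (Measurable.lintegral_prod_right' (f := fun q : ℝ × α =>
      if q.1 < f q.2 then ENNReal.ofReal (f q.2) else 0) ?_)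
    exact Measurable.ite (measurableSet_lt measurable_fst (hf.comp measurable_snd)) (by fun_prop)
      measurable_const
  have hm2 : Measurable fun s : ℝ => ENNReal.ofReal (s ^ (p - 3)) *
      ∫⁻ x, (if f x ≤ s then ENNReal.ofReal (f x ^ 2) else 0) ∂m := by
    refine Measurable.mul (by fun_prop) (Measurable.lintegral_prod_right' (f := fun q : ℝ × α =>
      if f q.2 ≤ q.1 then ENNReal.ofReal (f q.2 ^ 2) else 0) ?_)
    exact Measurable.ite (measurableSet_le (hf.comp measurable_snd) measurable_fst) (by fun_prop)
      measurable_const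
  rw [hLHS]
  have hint := lintegral_mono_ae (μ := volume.restrict (Set.Ioi (0 : ℝ)))
    ((ae_restrict_mem measurableSet_Ioi).mono hpt)
  rw [lintegral_add_left (hm1.const_mul _), lintegral_const_mul _ hm1, lintegral_const_mul _ hm2,
    lintegral_rpow_mul_lintegral_ite_lt hp1 hf hf0,
    lintegral_rpow_mul_lintegral_ite_le hp1 hp2 hf hf0] at hint
  refine (mul_le_mul_right hint _).trans (le_of_eq ?_)
  have hq1 : 0 ≤ p - 1 := by linarith
  have hq2 : 0 ≤ 2 - p := by linarith
  rw [← mul_assoc, ← mul_assoc, ← add_mul, ← mul_assoc, ← ENNReal.ofReal_mul (by positivity),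
    ← ENNReal.ofReal_mul (by positivity), ← ENNReal.ofReal_add (by positivity) (by positivity),
    ← ENNReal.ofReal_mul (by linarith)]
  congr 2
  ring

/-! ### The finite Fourier transform on `L^p[0,1]` -/

theorem unitIntervalMeasure_eq : unitIntervalMeasure = volume.restrict (Set.Ioc (0 : ℝ) 1) :=
  (Measure.restrict_congr_set Ioc_ae_eq_Icc).symm

instance : IsFiniteMeasure unitIntervalMeasure := by
  rw [unitIntervalMeasure_eq]
  infer_instance

theorem finiteFourier_eq (b : ℝ) (g : ℝ → ℂ) (z : ℂ) :
    finiteFourier b g z =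
      ∫ t, g t * Complex.exp (Complex.I * (b : ℂ) * z * (t : ℂ)) ∂unitIntervalMeasure := by
  rw [finiteFourier, intervalIntegral.integral_of_le zero_le_one, unitIntervalMeasure_eq]

theorem finiteFourier_congr_ae {b : ℝ} {g g' : ℝ → ℂ} (hgg : g =ᵐ[unitIntervalMeasure] g') (z : ℂ) :
    finiteFourier b g z = finiteFourier b g' z := by
  rw [finiteFourier_eq, finiteFourier_eq]
  refine integral_congr_ae ?_
  filter_upwards [hgg] with t ht
  rw [ht]

theorem norm_exp_le_of_mem_horizontalStrip {b h : ℝ} {z : ℂ} (hz : z ∈ horizontalStrip h) {t : ℝ}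
    (ht : t ∈ Set.Ioc (0 : ℝ) 1) :
    ‖Complex.exp (Complex.I * (b : ℂ) * z * (t : ℂ))‖ ≤ Real.exp (|b| * h) := by
  rw [Complex.norm_exp]
  refine Real.exp_le_exp.2 ?_
  have h1 : (Complex.I * (b : ℂ) * z * (t : ℂ)).re = -(b * z.im) * t := by simp
  rw [h1]
  have hz : |z.im| ≤ h := hz
  calc -(b * z.im) * t ≤ |(-(b * z.im) * t)| := le_abs_self _
    _ = |b| * |z.im| * t := by rw [abs_mul, abs_neg, abs_mul, abs_of_pos ht.1]
    _ ≤ |b| * |z.im| * 1 := by gcongr; exact ht.2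
    _ ≤ |b| * h := by rw [mul_one]; gcongr

theorem integrable_mul_exp {b : ℝ} {g : ℝ → ℂ} (hg : Integrable g unitIntervalMeasure) (z : ℂ) :
    Integrable (fun t : ℝ => g t * Complex.exp (Complex.I * (b : ℂ) * z * (t : ℂ)))
      unitIntervalMeasure := by
  refine hg.mul_bdd (c := Real.exp (|b| * |z.im|)) (by fun_prop) ?_
  rw [unitIntervalMeasure_eq]
  filter_upwards [ae_restrict_mem measurableSet_Ioc] with t ht
  exact norm_exp_le_of_mem_horizontalStrip (show |z.im| ≤ |z.im| from le_rfl) ht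

theorem finiteFourier_add {b : ℝ} {g₁ g₂ : ℝ → ℂ} (h₁ : Integrable g₁ unitIntervalMeasure)
    (h₂ : Integrable g₂ unitIntervalMeasure) (z : ℂ) :
    finiteFourier b (g₁ + g₂) z = finiteFourier b g₁ z + finiteFourier b g₂ z := by
  rw [finiteFourier_eq, finiteFourier_eq, finiteFourier_eq,
    ← integral_add (integrable_mul_exp h₁ z) (integrable_mul_exp h₂ z)]
  simp only [Pi.add_apply, add_mul]

theorem norm_finiteFourier_le {b h : ℝ} {g : ℝ → ℂ} (hg : Integrable g unitIntervalMeasure) {z : ℂ}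
    (hz : z ∈ horizontalStrip h) :
    ‖finiteFourier b g z‖ ≤ Real.exp (|b| * h) * ∫ t, ‖g t‖ ∂unitIntervalMeasure := by
  rw [finiteFourier_eq, ← integral_const_mul]
  refine norm_integral_le_of_norm_le (hg.norm.const_mul _) ?_
  rw [unitIntervalMeasure_eq]
  filter_upwards [ae_restrict_mem measurableSet_Ioc] with t ht
  rw [norm_mul, mul_comm]
  exact mul_le_mul_of_nonneg_right (norm_exp_le_of_mem_horizontalStrip hz ht) (norm_nonneg _)

theorem lintegral_norm_rpow_eq {p : ℝ} (hp : 0 < p) {g : ℝ → ℂ}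
    (hg : MemLp g (ENNReal.ofReal p) unitIntervalMeasure) :
    ∫⁻ t, ENNReal.ofReal (‖g t‖ ^ p) ∂unitIntervalMeasure =
      ENNReal.ofReal (unitIntervalLpNorm p g ^ p) := by
  have h1 : ∀ t, ENNReal.ofReal (‖g t‖ ^ p) = ‖g t‖ₑ ^ p := fun t => by
    rw [← ENNReal.ofReal_rpow_of_nonneg (norm_nonneg _) hp.le, ofReal_norm]
  simp_rw [h1]
  rw [unitIntervalLpNorm, ← ENNReal.ofReal_rpow_of_nonneg ENNReal.toReal_nonneg hp.le,
    ENNReal.ofReal_toReal hg.2.ne, eLpNorm_eq_lintegral_rpow_enorm_toReal (by simpa using hp)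
      ENNReal.ofReal_ne_top, ENNReal.toReal_ofReal hp.le, ← ENNReal.rpow_mul,
    one_div_mul_cancel hp.ne', ENNReal.rpow_one]

theorem exists_sum_ofReal_sq_finiteFourier_le {b : ℝ} (hb : b ≠ 0) (h : ℝ) (d : ℕ) :
    ∃ C : ℝ, 0 ≤ C ∧ ∀ μ : ℤ → ℂ, IsIncompressible d μ → (∀ n : ℤ, μ n ∈ horizontalStrip h) →
      ∀ g : ℝ → ℂ, MemLp g 2 unitIntervalMeasure → ∀ S : Finset ℤ,
        ∑ n ∈ S, ENNReal.ofReal (‖finiteFourier b g (μ n)‖ ^ 2) ≤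
          ENNReal.ofReal C * ∫⁻ t, ENNReal.ofReal (‖g t‖ ^ 2) ∂unitIntervalMeasure := by
  obtain ⟨C, hC0, hC⟩ := exists_sum_sq_finiteFourier_le hb h d
  refine ⟨C, hC0, fun μ hμ hstrip g hg S => ?_⟩
  rw [unitIntervalMeasure_eq] at hg ⊢
  have h1 := ENNReal.ofReal_le_ofReal (hC μ hμ hstrip g hg S)
  rwa [ENNReal.ofReal_sum_of_nonneg fun _ _ => sq_nonneg _, ENNReal.ofReal_mul hC0,
    intervalIntegral.integral_of_le zero_le_one,
    ofReal_integral_eq_lintegral_ofReal hg.norm.integrable_sq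
      (Filter.Eventually.of_forall fun _ => sq_nonneg _)] at h1

/-! ### Weighted Paley inequality -/

/-- A Paley inequality with arbitrary weights of linear counting function. -/
theorem exists_sum_weighted_finiteFourier_le {b : ℝ} (hb : b ≠ 0) {p : ℝ} (hp1 : 1 < p)
    (hp2 : p ≤ 2) (h : ℝ) (d : ℕ) {A : ℝ} (hA0 : 0 ≤ A) :
    ∃ C : ℝ, 0 < C ∧ ∀ μ : ℤ → ℂ, IsIncompressible d μ → (∀ n : ℤ, μ n ∈ horizontalStrip h) →
      ∀ g : ℝ → ℂ, MemLp g (ENNReal.ofReal p) unitIntervalMeasure →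
        ∀ (S : Finset ℤ) (w : ℤ → ℝ), (∀ n ∈ S, 0 < w n) →
          (∀ y, 0 < y → ((S.filter fun n => w n ≤ y).card : ℝ) ≤ A * y) →
          ∑ n ∈ S, w n ^ (p - 2) * ‖finiteFourier b g (μ n)‖ ^ p ≤
            C * unitIntervalLpNorm p g ^ p := by
  obtain ⟨B, hB0, hB⟩ := exists_sum_ofReal_sq_finiteFourier_le hb h d
  have hp0 : 0 < p := by linarith
  suffices hsuff : ∃ C : ℝ, 0 ≤ C ∧ ∀ μ : ℤ → ℂ, IsIncompressible d μ →
      (∀ n : ℤ, μ n ∈ horizontalStrip h) →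
      ∀ g : ℝ → ℂ, MemLp g (ENNReal.ofReal p) unitIntervalMeasure → Measurable g →
        ∀ (S : Finset ℤ) (w : ℤ → ℝ), (∀ n ∈ S, 0 < w n) →
          (∀ y, 0 < y → ((S.filter fun n => w n ≤ y).card : ℝ) ≤ A * y) →
          ∑ n ∈ S, ENNReal.ofReal (w n ^ (p - 2) * ‖finiteFourier b g (μ n)‖ ^ p) ≤
            ENNReal.ofReal C * ∫⁻ t, ENNReal.ofReal (‖g t‖ ^ p) ∂unitIntervalMeasure by
    obtain ⟨C, hC0, hC⟩ := hsuff
    -- Adding 1 makes the constant strictly positive. A measurable representative of `g` suffices,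
    -- since transform and norm depend only on the class of `g`.
    refine ⟨C + 1, by positivity, fun μ hμ hstrip g hg S w hw hA => ?_⟩
    have hmk : g =ᵐ[unitIntervalMeasure] hg.1.mk g := hg.1.ae_eq_mk
    have hg' : MemLp (hg.1.mk g) (ENNReal.ofReal p) unitIntervalMeasure := hg.ae_eq hmk
    have h1 := hC μ hμ hstrip _ hg' hg.1.stronglyMeasurable_mk.measurable S w hw hA
    have hnorm : unitIntervalLpNorm p (hg.1.mk g) = unitIntervalLpNorm p g := by
      exact congrArg ENNReal.toReal (eLpNorm_congr_ae hmk.symm)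
    have hN : 0 ≤ unitIntervalLpNorm p g ^ p := Real.rpow_nonneg ENNReal.toReal_nonneg _
    simp_rw [← finiteFourier_congr_ae hmk] at h1
    rw [lintegral_norm_rpow_eq hp0 hg', hnorm, ← ENNReal.ofReal_mul hC0,
      ← ENNReal.ofReal_sum_of_nonneg (fun n hn => mul_nonneg (Real.rpow_nonneg (hw n hn).le _)
        (Real.rpow_nonneg (norm_nonneg _) _)),
      ENNReal.ofReal_le_ofReal_iff (mul_nonneg hC0 hN)] at h1
    linarith
  -- At `p = 2` the weights disappear and the `L²` bound is the claim; interpolation would produce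
  -- the divergent constant `1/(2-p)`.
  rcases hp2.eq_or_lt with rfl | hp2
  · refine ⟨B, hB0, fun μ hμ hstrip g hg _ S w _ _ => ?_⟩
    rw [ENNReal.ofReal_ofNat] at hg
    simpa using hB μ hμ hstrip g hg S
  · set K := Real.exp (|b| * h) with hK
    refine ⟨p * (4 * A * K / (p - 1) + 4 * B / (2 - p)), ?_, ?_⟩
    · have : 0 < p - 1 := by linarith
      have : 0 < 2 - p := by linarith
      positivity
    intro μ hμ hstrip g hg hgm S w hw hA
    have hgi : Integrable g unitIntervalMeasure := hg.integrable (by simpa using hp1.le)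
    refine sum_weighted_rpow_le hp1 hp2 hw hA hA0 (Real.exp_pos _).le hB0
      (fun n => norm_nonneg _) hgm.norm (fun _ => norm_nonneg _) fun s hs => ?_
    have hm1 : MeasurableSet {t | s < ‖g t‖} := measurableSet_lt measurable_const hgm.norm
    have hm2 : MeasurableSet {t | ‖g t‖ ≤ s} := measurableSet_le hgm.norm measurable_const
    -- Truncation at height `s`: the large part is integrable and receives the sup bound; the small
    -- part is bounded, hence in `L²`.
    set g₁ := {t | s < ‖g t‖}.indicator g with hg₁
    set g₂ := {t | ‖g t‖ ≤ s}.indicator g with hg₂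
    have hi1 : Integrable g₁ unitIntervalMeasure := hgi.indicator hm1
    have hi2 : Integrable g₂ unitIntervalMeasure := hgi.indicator hm2
    have hsum : g = g₁ + g₂ := by
      funext t
      by_cases ht : s < ‖g t‖ <;> simp [hg₁, hg₂, ht, not_le.2, not_lt.1]
    have hL2 : MemLp g₂ 2 unitIntervalMeasure := by
      refine MemLp.of_bound hi2.1 s (Filter.Eventually.of_forall fun t => ?_)
      by_cases ht : ‖g t‖ ≤ s <;> simp [hg₂, ht, hs.le]
    refine ⟨K * ∫ t, ‖g₁ t‖ ∂unitIntervalMeasure, fun n => ‖finiteFourier b g₂ (μ n)‖, ?_,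
      fun n _ => ?_, ?_, ?_⟩
    · exact mul_nonneg (Real.exp_pos _).le (integral_nonneg fun _ => norm_nonneg _)
    · conv_lhs => rw [hsum, finiteFourier_add hi1 hi2]
      exact (norm_add_le _ _).trans (add_le_add_left (norm_finiteFourier_le hi1 (hstrip n)) _)
    · rw [ENNReal.ofReal_mul (Real.exp_pos _).le, ofReal_integral_eq_lintegral_ofReal hi1.norm
        (Filter.Eventually.of_forall fun _ => norm_nonneg _)]
      refine le_of_eq (congrArg _ (lintegral_congr fun t => ?_))
      by_cases ht : s < ‖g t‖ <;> simp [hg₁, ht]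
    · refine (hB μ hμ hstrip g₂ hL2 S).trans (le_of_eq (congrArg _ (lintegral_congr fun t => ?_)))
      by_cases ht : ‖g t‖ ≤ s <;> simp [hg₂, ht]

/-! ### From Paley to Hausdorff-Young by ranking -/

/-- Ranking a finite family in decreasing order gives weights with linear counting function. -/
theorem card_filter_rank_le {ι : Type*} (S : Finset ι) (a : ι → ℝ) {y : ℝ} (hy : 0 < y) :
    ((S.filter fun n => ((S.filter fun k => a n ≤ a k).card : ℝ) ≤ y).card : ℝ) ≤ 1 * y := by
  classical
  rw [one_mul]
  set T := S.filter fun n => ((S.filter fun k => a n ≤ a k).card : ℝ) ≤ y with hT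
  rcases T.eq_empty_or_nonempty with h0 | h0
  · rw [h0]
    simpa using hy.le
  -- For `n` with the smallest value in `T`, all of `T` is counted in the rank of `n`, which is at
  -- most `y`.
  · obtain ⟨n, hn, hmin⟩ := T.exists_min_image a h0
    refine le_trans ?_ (Finset.mem_filter.1 hn).2
    exact_mod_cast Finset.card_le_card fun k hk =>
      Finset.mem_filter.2 ⟨(Finset.mem_filter.1 hk).1, hmin k hk⟩

/-- A Paley inequality for rank weights implies the Hausdorff-Young inequality. -/
theorem sum_rpow_conjugate_le_of_rank {ι : Type*} {S : Finset ι} {a : ι → ℝ} {p p' M : ℝ}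
    (hp1 : 1 < p) (hp2 : p ≤ 2) (hpp' : 1 / p' + 1 / p = 1) (ha : ∀ n, 0 ≤ a n)
    (hM : ∑ n ∈ S, ((S.filter fun k => a n ≤ a k).card : ℝ) ^ (p - 2) * a n ^ p ≤ M) :
    ∑ n ∈ S, a n ^ p' ≤ M ^ (p' / p) := by
  have hp0 : 0 < p := by linarith
  have hq0 : p' = p / (p - 1) := by
    have h0 : p' ≠ 0 := by
      rintro rfl
      rw [div_zero, zero_add, div_eq_one_iff_eq hp0.ne'] at hpp'
      linarith
    have : p - 1 ≠ 0 := by linarith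
    field_simp at hpp' ⊢
    linarith
  have hq1 : 0 < p - 1 := by linarith
  have hq : 0 < p' := by rw [hq0]; positivity
  set w : ι → ℝ := fun n => ((S.filter fun k => a n ≤ a k).card : ℝ) with hwdef
  have hterm : ∀ n ∈ S, 0 ≤ w n ^ (p - 2) * a n ^ p := fun n _ =>
    mul_nonneg (Real.rpow_nonneg (Nat.cast_nonneg _) _) (Real.rpow_nonneg (ha n) _)
  have hM0 : 0 ≤ M := (Finset.sum_nonneg hterm).trans hM
  have hw1 : ∀ n ∈ S, 0 < w n := by
    intro n hn
    exact Nat.cast_pos.2 (Finset.card_pos.2 ⟨n, Finset.mem_filter.2 ⟨hn, le_rfl⟩⟩)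
  -- A weak-type bound: the `w n` indices with value at least `a n` have rank at most `w n`. As `p -
  -- 2 ≤ 0`, each of their terms is at least the term of `n`.
  have hweak : ∀ n ∈ S, w n ^ (p - 1) * a n ^ p ≤ M := by
    intro n hn
    have hwn := hw1 n hn
    calc w n ^ (p - 1) * a n ^ p = w n * (w n ^ (p - 2) * a n ^ p) := by
          rw [← mul_assoc, ← Real.rpow_one_add' hwn.le (by linarith)]
          congr 2
          ring
      _ = ∑ k ∈ S.filter (fun k => a n ≤ a k), w n ^ (p - 2) * a n ^ p := by
          rw [Finset.sum_const, nsmul_eq_mul]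
      _ ≤ ∑ k ∈ S.filter (fun k => a n ≤ a k), w k ^ (p - 2) * a k ^ p := by
          refine Finset.sum_le_sum fun k hk => ?_
          obtain ⟨hkS, hk⟩ := Finset.mem_filter.1 hk
          have hwk : w k ≤ w n := by
            refine Nat.cast_le.2 (Finset.card_le_card fun j hj => ?_)
            obtain ⟨hjS, hj⟩ := Finset.mem_filter.1 hj
            exact Finset.mem_filter.2 ⟨hjS, hk.trans hj⟩
          refine mul_le_mul (Real.rpow_le_rpow_of_nonpos (hw1 k hkS) hwk (by linarith))
            (Real.rpow_le_rpow (ha n) hk hp0.le) (Real.rpow_nonneg (ha n) _)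
            (Real.rpow_nonneg (hw1 k hkS).le _)
      _ ≤ ∑ k ∈ S, w k ^ (p - 2) * a k ^ p :=
          Finset.sum_le_sum_of_subset_of_nonneg (Finset.filter_subset _ _)
            fun k hk _ => hterm k hk
      _ ≤ M := hM
  have hexp : (p' - p) / p * (p - 1) = 2 - p := by
    rw [hq0]
    field_simp
    ring
  have he0 : 0 ≤ (p' - p) / p := by
    by_contra hneg
    nlinarith
  -- Write `a^p' = (w^(p-2) a^p) (w^(p-1) a^p)^((p'-p)/p)`, where the powers of `w` cancel by
  -- `hexp`, and bound the second factor by `hweak`.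
  have hpoint : ∀ n ∈ S, a n ^ p' ≤ (w n ^ (p - 2) * a n ^ p) * M ^ ((p' - p) / p) := by
    intro n hn
    have hwn := hw1 n hn
    have h1 := Real.rpow_le_rpow (mul_nonneg (Real.rpow_nonneg hwn.le _)
      (Real.rpow_nonneg (ha n) _)) (hweak n hn) he0
    refine le_trans (le_of_eq ?_) (mul_le_mul_of_nonneg_left h1 (hterm n hn))
    rcases (ha n).eq_or_lt with h0 | h0
    · rw [← h0, Real.zero_rpow hq.ne', Real.zero_rpow hp0.ne']
      simp
    · rw [Real.mul_rpow (Real.rpow_nonneg hwn.le _) (Real.rpow_nonneg h0.le _),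
        ← Real.rpow_mul hwn.le, ← Real.rpow_mul h0.le, mul_comm (p - 1), hexp,
        mul_div_cancel₀ _ hp0.ne', mul_mul_mul_comm, ← Real.rpow_add hwn, ← Real.rpow_add h0]
      simp
  calc ∑ n ∈ S, a n ^ p' ≤ ∑ n ∈ S, (w n ^ (p - 2) * a n ^ p) * M ^ ((p' - p) / p) :=
        Finset.sum_le_sum hpoint
    _ = (∑ n ∈ S, w n ^ (p - 2) * a n ^ p) * M ^ ((p' - p) / p) := by rw [Finset.sum_mul]
    _ ≤ M * M ^ ((p' - p) / p) :=
        mul_le_mul_of_nonneg_right hM (Real.rpow_nonneg hM0 _)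
    _ = M ^ (p' / p) := by
        rw [← Real.rpow_one_add' hM0 (by positivity)]
        congr 1
        field_simp
        ring

/-! ### The weights `1 + |n|` and the conclusion -/

theorem card_filter_one_add_abs_le (S : Finset ℤ) {y : ℝ} (hy : 0 < y) :
    ((S.filter fun n : ℤ => 1 + |(n : ℝ)| ≤ y).card : ℝ) ≤ 2 * y := by
  rcases lt_or_ge y 1 with h1 | h1
  · rw [Finset.filter_false_of_mem]
    · simpa using hy.le
    · intro n _
      linarith [abs_nonneg (n : ℝ)]
  · have hsub : (S.filter fun n : ℤ => 1 + |(n : ℝ)| ≤ y) ⊆ Finset.Icc (-⌊y - 1⌋) ⌊y - 1⌋ := by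
      intro n hn
      have h2 := (Finset.mem_filter.1 hn).2
      have h3 : |n| ≤ ⌊y - 1⌋ := by
        rw [Int.le_floor]
        push_cast
        linarith
      exact Finset.mem_Icc.2 (abs_le.1 h3)
    have h4 : 0 ≤ ⌊y - 1⌋ := Int.floor_nonneg.2 (by linarith)
    have h5 := Finset.card_le_card hsub
    rw [Int.card_Icc] at h5
    have h6 : ((S.filter fun n : ℤ => 1 + |(n : ℝ)| ≤ y).card : ℤ) ≤ 2 * ⌊y - 1⌋ + 1 := by omega
    have h7 : ((S.filter fun n : ℤ => 1 + |(n : ℝ)| ≤ y).card : ℝ) ≤ 2 * (⌊y - 1⌋ : ℝ) + 1 := by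
      exact_mod_cast h6
    linarith [Int.floor_le (y - 1)]

theorem mainTheorem12 (b : ℝ) (hb : b ≠ 0) (p p' : ℝ) (hp1 : 1 < p) (hp2 : p ≤ 2)
    (hpp' : 1 / p' + 1 / p = 1) (h : ℝ) (hh : 0 ≤ h) (d : ℕ) :
    ∃ C : ℝ, 0 < C ∧
      ∀ μ : ℤ → ℂ, IsIncompressible d μ → (∀ n : ℤ, μ n ∈ horizontalStrip h) →
        ∀ g : ℝ → ℂ, MemLp g (ENNReal.ofReal p) unitIntervalMeasure →
          (Summable (fun n : ℤ => ‖finiteFourier b g (μ n)‖ ^ p') ∧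
            ∑' n : ℤ, ‖finiteFourier b g (μ n)‖ ^ p' ≤ C * unitIntervalLpNorm p g ^ p') ∧
          (Summable (fun n : ℤ =>
              (1 + |(n : ℝ)|) ^ (p - 2) * ‖finiteFourier b g (μ n)‖ ^ p) ∧
            ∑' n : ℤ, (1 + |(n : ℝ)|) ^ (p - 2) * ‖finiteFourier b g (μ n)‖ ^ p ≤
              C * unitIntervalLpNorm p g ^ p) := by
  -- The counting constants are `A = 1` for ranks and `A = 2` for the weights `1 + |n|`.
  obtain ⟨C₁, hC₁, H₁⟩ := exists_sum_weighted_finiteFourier_le hb hp1 hp2 h d zero_le_one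
  obtain ⟨C₂, hC₂, H₂⟩ := exists_sum_weighted_finiteFourier_le hb hp1 hp2 h d zero_le_two
  have hC : 0 < C₁ ^ (p' / p) := Real.rpow_pos_of_pos hC₁ _
  refine ⟨C₁ ^ (p' / p) + C₂, by positivity, fun μ hμ hstrip g hg => ?_⟩
  set N := unitIntervalLpNorm p g with hN
  have hN0 : 0 ≤ N := ENNReal.toReal_nonneg
  have hp0 : 0 < p := by linarith
  have hY : ∀ S : Finset ℤ, ∑ n ∈ S, ‖finiteFourier b g (μ n)‖ ^ p' ≤
      (C₁ ^ (p' / p) + C₂) * N ^ p' := by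
    intro S
    have h1 := sum_rpow_conjugate_le_of_rank hp1 hp2 hpp' (fun n => norm_nonneg _)
      (H₁ μ hμ hstrip g hg S
        (fun n => ((S.filter fun k => ‖finiteFourier b g (μ n)‖ ≤
          ‖finiteFourier b g (μ k)‖).card : ℝ))
        (fun n hn => Nat.cast_pos.2 (Finset.card_pos.2 ⟨n, Finset.mem_filter.2 ⟨hn, le_rfl⟩⟩))
        fun y hy => card_filter_rank_le S (fun n => ‖finiteFourier b g (μ n)‖) hy)
    rw [Real.mul_rpow hC₁.le (Real.rpow_nonneg hN0 _), ← Real.rpow_mul hN0,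
      mul_div_cancel₀ _ hp0.ne'] at h1
    refine h1.trans (mul_le_mul_of_nonneg_right (by linarith) (Real.rpow_nonneg hN0 _))
  have hP : ∀ S : Finset ℤ, ∑ n ∈ S, (1 + |(n : ℝ)|) ^ (p - 2) * ‖finiteFourier b g (μ n)‖ ^ p ≤
      (C₁ ^ (p' / p) + C₂) * N ^ p := fun S =>
    (H₂ μ hμ hstrip g hg S (fun n => 1 + |(n : ℝ)|) (fun n _ => by positivity)
      fun y hy => card_filter_one_add_abs_le S hy).trans
        (mul_le_mul_of_nonneg_right (by linarith) (Real.rpow_nonneg hN0 _))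
  have h1 : 0 ≤ fun n : ℤ => ‖finiteFourier b g (μ n)‖ ^ p' := fun n => by positivity
  have h2 : 0 ≤ fun n : ℤ => (1 + |(n : ℝ)|) ^ (p - 2) * ‖finiteFourier b g (μ n)‖ ^ p :=
    fun n => by positivity
  exact ⟨⟨summable_of_sum_le h1 hY, Real.tsum_le_of_sum_le h1 hY⟩,
    summable_of_sum_le h2 hP, Real.tsum_le_of_sum_le h2 hP⟩
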